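/- Let $\mathcal X$ be the linear space of all (real- or complex-valued) measurable functions on $(0,\infty)$ with Lebesgue measure $m$, modulo equality almost everywhere. Let $L_0\subset\mathcal X$ be the space of functions whose support has finite measure, and let $L_r$, $0<r\le\infty$, be the usual Lebesgue spaces on $(0,\infty)$ with (quasi-)norm $\|\cdot\|_r$. For a linear operator $T:\mathcal X\to\mathcal X$ put $$\|T\|_{L_0\to L_0}=\sup_{x\in L_0}\frac{m(\operatorname{supp}(Tx))}{m(\operatorname{supp}(x))},\qquad \|T\|_{L_r\to L_r}=\sup_{x\in L_r}\frac{\|Tx\|_r}{\|x\|_r}\quad(0<r\le\infty),$$ with $0/0=0$ and $\|y\|_r=\infty$ if $y\notin L_r$. Let $\mu(t,u)=\inf\{s\ge 0: m(\{|u|>s\})\le t\}$, $t>0$, be the right-continuous decreasing rearrangement $\mu(u)$ of $u$. Tail majorization $v\prec\prec_{tl}u$ means $\int_t^\infty\mu(s,v)\,ds\le\int_t^\infty\mu(s,u)\,ds$ for all $t>0$, and head majorization $v\prec\prec_{hd}u$ means $\int_0^t\mu(s,v)\,ds\le\int_0^t\mu(s,u)\,ds$ for all $t>0$. (a) Let $0<q<\infty$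 and let $f,g\in L_0+L_q$ be such that $f=\mu(f)$, $g=\mu(g)$ and $|g|^q\prec\prec_{tl}|f|^q$. Then there is a linear operator $T:\mathcal X\to\mathcal X$ such that $Tf=g$ and $$\|T\|_{L_0\to L_0}\le 4,\qquad \|T\|_{L_q\to L_q}\le 2\cdot 3^{1/q}.$$ (b) Let $0<p<\infty$ and let $f,g\in L_p+L_\infty$ be such that $f=\mu(f)$, $g=\mu(g)$ and $|g|^p\prec\prec_{hd}|f|^p$. Then there is a linear operator $T:\mathcal X\to\mathcal X$ such that $Tf=g$ and $$\|T\|_{L_p\to L_p}\le 2\cdot 3^{1/p},\qquad \|T\|_{L_\infty\to L_\infty}\le 2\cdot 2^{1/p}.$$ -/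

import Mathlib

open MeasureTheory Set
open scoped ENNReal

noncomputable section

namespace HeadTail

/-- Lebesgue measure on the half-line `(0, ∞)`. -/
def halfLine : Measure ℝ := volume.restrict (Ioi 0)

/-- The linear space of all measurable scalar functions on `(0, ∞)`, modulo equality almost
everywhere. -/
abbrev X (𝕜 : Type*) [RCLike 𝕜] : Type _ := ℝ →ₘ[halfLine] 𝕜

/-- The measure of the support of a function on `(0, ∞)`. -/
def suppMeasure {𝕜 : Type*} [RCLike 𝕜] (f : X 𝕜) : ℝ≥0∞ := halfLine {t | f t ≠ 0}

/-- The space `L_0(0, ∞)` of functions whose support has finite measure. -/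
def LZero (𝕜 : Type*) [RCLike 𝕜] : AddSubgroup (X 𝕜) where
  carrier := {f | suppMeasure f < ∞}
  zero_mem' := by
    have h : suppMeasure (0 : X 𝕜) = 0 := by
      have h0 : ∀ᵐ t ∂halfLine, (0 : X 𝕜) t = 0 := AEEqFun.coeFn_zero
      exact ae_iff.1 h0
    simp [h]
  add_mem' := by
    intro f g hf hg
    have h : suppMeasure (f + g) ≤ suppMeasure f + suppMeasure g := by
      refine le_trans (measure_mono_ae ?_)
        (measure_union_le {t | f t ≠ 0} {t | g t ≠ 0})
      filter_upwards [AEEqFun.coeFn_add f g] with t ht hne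
      by_contra hcon
      have h2 : f t = 0 ∧ g t = 0 := by
        constructor
        · by_contra h; exact hcon (Or.inl h)
        · by_contra h; exact hcon (Or.inr h)
      exact hne (by simp [ht, h2.1, h2.2])
    exact lt_of_le_of_lt h (ENNReal.add_lt_top.2 ⟨hf, hg⟩)
  neg_mem' := by
    intro f hf
    have h : suppMeasure (-f) ≤ suppMeasure f := by
      refine measure_mono_ae ?_
      filter_upwards [AEEqFun.coeFn_neg f] with t ht hne h0
      exact hne (by simp [ht, h0])
    exact lt_of_le_of_lt h hf

/-- The space `L_r(0, ∞)` for `0 < r ≤ ∞`. -/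
abbrev LSpace (𝕜 : Type*) [RCLike 𝕜] (r : ℝ≥0∞) : AddSubgroup (X 𝕜) := Lp 𝕜 r halfLine

/-- The right-continuous decreasing rearrangement
`μ(t, u) = inf {s ≥ 0 : m({|u| > s}) ≤ t}` of a function `u` on `(0, ∞)`. -/
def rearr {E : Type*} [NormedAddCommGroup E] (u : ℝ → E) (t : ℝ) : ℝ≥0∞ :=
  sInf {s : ℝ≥0∞ | halfLine {x | s < ‖u x‖ₑ} ≤ ENNReal.ofReal t}

/-- `f = μ(f)`: the function `f` coincides with its own decreasing rearrangement. -/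
def IsOwnRearr {𝕜 : Type*} [RCLike 𝕜] (f : X 𝕜) : Prop :=
  ∀ᵐ t ∂halfLine, f t = (((rearr f t).toReal : ℝ) : 𝕜)

/-- Head majorization of `v` by `u`:
`∫_0^t μ(s, v) ds ≤ ∫_0^t μ(s, u) ds` for all `t > 0`. -/
def HeadMajorized (v u : ℝ → ℝ) : Prop :=
  ∀ t : ℝ, 0 < t → ∫⁻ s in Ioc 0 t, rearr v s ≤ ∫⁻ s in Ioc 0 t, rearr u s

/-- Tail majorization of `v` by `u`:
`∫_t^∞ μ(s, v) ds ≤ ∫_t^∞ μ(s, u) ds` for all `t > 0`. -/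
def TailMajorized (v u : ℝ → ℝ) : Prop :=
  ∀ t : ℝ, 0 < t → ∫⁻ s in Ioi t, rearr v s ≤ ∫⁻ s in Ioi t, rearr u s

/-- `‖T‖_{L_0 → L_0} = sup_{x ∈ L_0} m(supp (T x)) / m(supp x)` (with `0 / 0 = 0`). -/
def opNormLZero {𝕜 : Type*} [RCLike 𝕜] (T : X 𝕜 →ₗ[𝕜] X 𝕜) : ℝ≥0∞ :=
  ⨆ x : LZero 𝕜, suppMeasure (T (x : X 𝕜)) / suppMeasure (x : X 𝕜)

/-- `‖T‖_{L_r → L_r} = sup_{x ∈ L_r} ‖T x‖_r / ‖x‖_r` (with `0 / 0 = 0`), where `‖T x‖_r = ∞`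
if `T x` is not in `L_r`; so a finite value means that `T` maps `L_r` to itself boundedly. -/
def opNormL {𝕜 : Type*} [RCLike 𝕜] (r : ℝ≥0∞) (T : X 𝕜 →ₗ[𝕜] X 𝕜) : ℝ≥0∞ :=
  ⨆ x : LSpace 𝕜 r, eLpNorm (T (x : X 𝕜)) r halfLine / eLpNorm (x : X 𝕜) r halfLine

end HeadTail

end

namespace HeadTail

/-! The operator is a weighted composition `T x = w · (x ∘ ψ)` with `w = μ(g) / (μ(f) ∘ ψ)`, so that
`T f = g` is automatic as soon as `μ(f) ∘ ψ` does not vanish where `μ(g) ≠ 0`. For finite `r`, an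
`L_r` bound says that the image under `ψ` of the measure `|w|^r dt` is at most `C dt`; an `L_∞`
bound is a bound on `w`; an `L_0` bound says that `{w ≠ 0} ∩ ψ⁻¹(B)` has measure at most `C m(B)`.
It remains to choose `ψ`, which is a mass transport between the decreasing densities `v = μ(g)^r`
and `u = μ(f)^r`.

Head case (`exists_head_transport`): let `U`, `V` be the integrals of `u`, `v` over `(0, t]` and
solve `2 U(ψ t) = V(t)`. Then `ψ` carries `v dt` into `2 u dt`. Since `2 U(ψ t) = V(t) ≤ U(t)`, at
least half of the mass of `u` on `(0, t]` lies beyond `ψ t`, and monotonicity gives `v(t) ≤ 2 u(ψ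
t)`.

Tail case (`exists_tail_transport`): with tail integrals solve `U(φ t) = V(t)`, which forces `φ t ≥
t` for a suitable solution. Use `φ` only where `u(φ t) ≤ v(t)`: there the weight is at least 1, so
the mass bound also bounds supports. Elsewhere `v(t) < u(φ t) ≤ u(t)`, and the identity map serves
with weight at most 1. Each of the two pieces costs `m(B)`, hence the constant 2. -/

/-! ### Comparison of measures on the line through half-open intervals -/

/-- The distribution function of a finite measure on the line, as a Stieltjes function. -/
noncomputable def stieltjesOfFinite (β : Measure ℝ) [IsFiniteMeasure β] : StieltjesFunction ℝ where
  toFun x := β.real (Iic x)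
  mono' _ _ h := measureReal_mono (Iic_subset_Iic.2 h)
  right_continuous' x := by
    rw [← continuousWithinAt_Ioi_iff_Ici]
    have hI : ⋂ r > x, Iic r = Iic x := by
      ext y
      simp only [mem_iInter, mem_Iic]
      exact ⟨fun h => le_of_forall_gt_imp_ge_of_dense h, fun h r hr => h.trans (le_of_lt hr)⟩
    have := tendsto_measure_biInter_gt (μ := β) (s := Iic) (a := x)
      (fun r _ => measurableSet_Iic.nullMeasurableSet) (fun i j _ h => Iic_subset_Iic.2 h)
      ⟨x + 1, by simp, measure_ne_top _ _⟩
    rw [hI] at this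
    exact (ENNReal.tendsto_toReal (measure_ne_top _ _)).comp this

/-- A finite measure on the line is the Carathéodory extension of its values on half-open intervals,
and the outer measure so generated is the largest one below those values. Thus `α` needs no
finiteness of its own. -/
theorem measure_le_of_Ioc_le_of_finite {α β : Measure ℝ} [IsFiniteMeasure β]
    (h : ∀ a b, α (Ioc a b) ≤ β (Ioc a b)) : α ≤ β := by
  have hlen : ∀ a b, ENNReal.ofReal (stieltjesOfFinite β b - stieltjesOfFinite β a)
      = β (Ioc a b) := by
    intro a b
    rcases le_total a b with hab | hab
    · have : Ioc a b = Iic b \ Iic a := by ext; simp [and_comm]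
      rw [this, ← ofReal_measureReal, measureReal_sdiff (Iic_subset_Iic.2 hab) measurableSet_Iic]
      rfl
    · rw [Ioc_eq_empty (not_lt.2 hab), measure_empty, ENNReal.ofReal_eq_zero]
      exact sub_nonpos.2 ((stieltjesOfFinite β).mono hab)
  have hβ : (stieltjesOfFinite β).measure = β := by
    refine Measure.ext_of_Ioc _ _ fun a b _ => ?_
    rw [StieltjesFunction.measure_Ioc, hlen]
  have hout : α.toOuterMeasure ≤ (stieltjesOfFinite β).outer := by
    refine OuterMeasure.le_ofFunction.2 fun s => ?_
    rw [StieltjesFunction.length, if_neg (not_isEmpty_of_nonempty ℝ)]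
    simp only [le_iInf_iff]
    intro a b hs
    rw [hlen]
    refine (measure_mono ?_).trans (h a b)
    intro x hx
    have h0 : x ∉ botSet := notMem_botSet_of_lt (sub_one_lt x)
    exact hs ⟨hx, h0⟩
  refine Measure.le_iff'.2 fun s => ?_
  calc α s ≤ (stieltjesOfFinite β).outer s := hout s
    _ = (stieltjesOfFinite β).measure s := by rw [StieltjesFunction.measure]; rfl
    _ = β s := by rw [hβ]

theorem iUnion_inter_Ioc_eq {B : Set ℝ} (hB : B ⊆ Ioi 0) :
    ⋃ n : ℕ, B ∩ Ioc (1 / ((n : ℝ) + 1)) (n + 1) = B := by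
  refine subset_antisymm (iUnion_subset fun n => inter_subset_left) fun x hx => ?_
  have hx0 : 0 < x := hB hx
  obtain ⟨m, hm⟩ := exists_nat_one_div_lt hx0
  obtain ⟨k, hk⟩ := exists_nat_ge x
  refine mem_iUnion.2 ⟨max m k, hx, ?_, ?_⟩
  · refine lt_of_le_of_lt ?_ hm
    have : (m : ℝ) ≤ (max m k : ℕ) := by exact_mod_cast le_max_left _ _
    gcongr
  · have : (k : ℝ) ≤ (max m k : ℕ) := by exact_mod_cast le_max_right _ _
    linarith

theorem monotone_inter_Ioc (B : Set ℝ) :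
    Monotone fun n : ℕ => B ∩ Ioc (1 / ((n : ℝ) + 1)) (n + 1) := by
  intro m k h
  have : (m : ℝ) ≤ k := by exact_mod_cast h
  refine inter_subset_inter_right _ (Ioc_subset_Ioc ?_ (by linarith))
  gcongr

theorem measure_le_of_inter_Ioc_le {α : Measure ℝ} {B : Set ℝ} (hB : B ⊆ Ioi 0) {M : ℝ≥0∞}
    (h : ∀ a b : ℝ, 0 < a → α (B ∩ Ioc a b) ≤ M) : α B ≤ M := by
  rw [← iUnion_inter_Ioc_eq hB, (monotone_inter_Ioc B).measure_iUnion]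
  exact iSup_le fun n => h _ _ (by positivity)

theorem measure_le_of_Ioc_le {α β : Measure ℝ} (h0 : α (Iic 0) = 0)
    (hβ : ∀ a b, 0 < a → β (Ioc a b) ≠ ∞)
    (h : ∀ a b, 0 < a → α (Ioc a b) ≤ β (Ioc a b)) : α ≤ β := by
  refine Measure.le_iff.2 fun B hB => ?_
  have hB' : α B ≤ α (B ∩ Ioi 0) := by
    calc α B ≤ α (B ∩ Ioi 0 ∪ Iic 0) := measure_mono fun x hx => by
            rcases lt_or_ge 0 x with hx0 | hx0
            · exact Or.inl ⟨hx, hx0⟩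
            · exact Or.inr hx0
      _ ≤ α (B ∩ Ioi 0) + α (Iic 0) := measure_union_le _ _
      _ = α (B ∩ Ioi 0) := by rw [h0, add_zero]
  refine hB'.trans (measure_le_of_inter_Ioc_le inter_subset_right fun a b ha => ?_)
  have : IsFiniteMeasure (β.restrict (Ioc a b)) :=
    ⟨by rw [Measure.restrict_apply_univ]; exact (hβ a b ha).lt_top⟩
  have hr : α.restrict (Ioc a b) ≤ β.restrict (Ioc a b) := by
    refine measure_le_of_Ioc_le_of_finite fun c d => ?_
    rw [Measure.restrict_apply measurableSet_Ioc, Measure.restrict_apply measurableSet_Ioc,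
      Ioc_inter_Ioc]
    exact h _ _ (lt_max_of_lt_right ha)
  calc α (B ∩ Ioi 0 ∩ Ioc a b) ≤ α (B ∩ Ioc a b) :=
        measure_mono (inter_subset_inter_left _ inter_subset_left)
    _ = α.restrict (Ioc a b) B := (Measure.restrict_apply hB).symm
    _ ≤ β.restrict (Ioc a b) B := hr B
    _ ≤ β B := Measure.restrict_apply_le _ _

/-- This turns the identity between primitives that defines a transport map into an inequality
between measures, without inverting `φ`. A compact piece of the preimage of `(a, b]` contains its
own infimum and supremum, so it is controlled by the single interval between them; absence of atoms
allows the left endpoint to be dropped. -/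
theorem map_restrict_le_of_Ioc_le {ν β : Measure ℝ} [NullSingletonClass ν] {φ : ℝ → ℝ} {P : Set ℝ}
    (hφ : Measurable φ) (hP : MeasurableSet P) (hP0 : P ⊆ Ioi 0)
    (hpos : ∀ t ∈ P, 0 < φ t) (hν : ∀ a b, 0 < a → ν (Ioc a b) ≠ ∞)
    (hβ : ∀ a b, 0 < a → β (Ioc a b) ≠ ∞)
    (h : ∀ s ∈ P, ∀ t ∈ P, s ≤ t → ν (Ioc s t) ≤ β (Ioc (φ s) (φ t))) :
    (ν.restrict P).map φ ≤ β := by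
  refine measure_le_of_Ioc_le ?_ hβ fun a b ha => ?_
  · rw [Measure.map_apply hφ measurableSet_Iic, Measure.restrict_apply (hφ measurableSet_Iic)]
    convert measure_empty (μ := ν)
    ext t
    simp only [mem_inter_iff, mem_preimage, mem_Iic, mem_empty_iff_false, iff_false, not_and]
    exact fun h1 h2 => (hpos t h2).not_ge h1
  rw [Measure.map_apply hφ measurableSet_Ioc, Measure.restrict_apply (hφ measurableSet_Ioc)]
  refine measure_le_of_inter_Ioc_le (inter_subset_right.trans hP0) fun c d hc => ?_
  have hE : MeasurableSet (φ ⁻¹' Ioc a b ∩ P ∩ Ioc c d) :=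
    ((hφ measurableSet_Ioc).inter hP).inter measurableSet_Ioc
  set E := φ ⁻¹' Ioc a b ∩ P ∩ Ioc c d
  have hfin : IsFiniteMeasure (ν.restrict (Ioc c d)) :=
    ⟨by rw [Measure.restrict_apply_univ]; exact (hν c d hc).lt_top⟩
  have hres : ∀ S ⊆ E, MeasurableSet S → ν S = ν.restrict (Ioc c d) S := fun S hS hSm => by
    rw [Measure.restrict_apply hSm, inter_eq_left.2 (hS.trans inter_subset_right)]
  rw [hres E subset_rfl hE]
  -- Inner regularity: it suffices to bound the compact subsets `K` of `E`, whose extreme points are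
  -- again mapped into `(a, b]`.
  refine le_of_forall_lt fun r hr => ?_
  obtain ⟨K, hKE, hK, hrK⟩ := hE.exists_lt_isCompact_of_ne_top (measure_ne_top _ _) hr
  rw [← hres K hKE hK.measurableSet] at hrK
  refine hrK.trans_le ?_
  rcases K.eq_empty_or_nonempty with rfl | hne
  · simp
  have hs := hKE (hK.sInf_mem hne)
  have ht := hKE (hK.sSup_mem hne)
  calc ν K ≤ ν (Icc (sInf K) (sSup K)) := measure_mono fun x hx =>
        ⟨csInf_le hK.bddBelow hx, le_csSup hK.bddAbove hx⟩
    _ = ν (Ioc (sInf K) (sSup K)) := (measure_congr Ioc_ae_eq_Icc).symm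
    _ ≤ β (Ioc (φ (sInf K)) (φ (sSup K))) :=
        h _ hs.1.2 _ ht.1.2 (csInf_le_csSup hne hK.bddBelow hK.bddAbove)
    _ ≤ β (Ioc a b) := measure_mono fun x hx =>
        ⟨hs.1.1.1.trans hx.1, hx.2.trans ht.1.1.2⟩

theorem measurable_piecewise_of_monotoneOn {φ : ℝ → ℝ} {P : Set ℝ} [DecidablePred (· ∈ P)]
    (hP : P.OrdConnected) (hmono : MonotoneOn φ P) :
    Measurable (P.piecewise φ id) := by
  refine measurable_of_Iic fun a => ?_
  have hset : P.piecewise φ id ⁻¹' Iic a = (P ∩ φ ⁻¹' Iic a) ∪ (Iic a \ P) := by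
    ext t
    by_cases ht : t ∈ P <;> simp [ht]
  rw [hset]
  refine (OrdConnected.measurableSet ?_).union (measurableSet_Iic.diff hP.measurableSet)
  refine ⟨fun x hx y hy z hz => ?_⟩
  have hzP := hP.out hx.1 hy.1 hz
  exact ⟨hzP, (hmono hzP hy.1 hz.2).trans hy.2⟩

theorem exists_setLIntegral_Ioc_eq {h : ℝ → ℝ≥0∞} (hm : Measurable h) {a b : ℝ} (hab : a ≤ b)
    {c : ℝ≥0∞} (hfin : ∫⁻ x in Ioc a b, h x ≠ ∞) (hc : c ≤ ∫⁻ x in Ioc a b, h x) :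
    ∃ s ∈ Icc a b, ∫⁻ x in Ioc a s, h x = c := by
  have hint : IntegrableOn (fun x => (h x).toReal) (Icc a b) := by
    rw [integrableOn_Icc_iff_integrableOn_Ioc]
    exact integrable_toReal_of_lintegral_ne_top hm.aemeasurable hfin
  have hfin' : ∀ s ∈ Icc a b, ∫⁻ x in Ioc a s, h x ≠ ∞ := fun s hs =>
    ne_top_of_le_ne_top hfin (lintegral_mono_set (Ioc_subset_Ioc_right hs.2))
  have heq : ∀ s ∈ Icc a b,
      ∫ x in Ioc a s, (h x).toReal = (∫⁻ x in Ioc a s, h x).toReal := fun s hs =>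
    integral_toReal hm.aemeasurable (ae_lt_top hm (hfin' s hs))
  have hcont := intervalIntegral.continuousOn_primitive hint
  have hmem : c.toReal ∈ Icc (∫ x in Ioc a a, (h x).toReal) (∫ x in Ioc a b, (h x).toReal) := by
    rw [heq b (right_mem_Icc.2 hab)]
    simpa using ENNReal.toReal_mono hfin hc
  obtain ⟨s, hs, hsc⟩ := intermediate_value_Icc hab hcont hmem
  refine ⟨s, hs, ?_⟩
  simp only [heq s hs] at hsc
  exact (ENNReal.toReal_eq_toReal_iff' (hfin' s hs) (ne_top_of_le_ne_top hfin hc)).1 hsc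

/-- Test the transport inequality against the function `1_B / u`. The bound `u * u⁻¹ ≤ 1` holds in
`ℝ≥0∞` even where `u` is `0` or `∞`. -/
theorem setLIntegral_div_comp_le {μ : Measure ℝ} {u v : ℝ → ℝ≥0∞} {ψ : ℝ → ℝ} {P : Set ℝ} {c : ℝ≥0∞}
    (hu : Measurable u) (hv : Measurable v) (hψ : Measurable ψ) (hP : MeasurableSet P)
    (h : ((μ.withDensity v).restrict P).map ψ ≤ c • μ.withDensity u)
    {B : Set ℝ} (hB : MeasurableSet B) :
    ∫⁻ t in P ∩ ψ ⁻¹' B, v t / u (ψ t) ∂μ ≤ c * μ B := by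
  have hg : Measurable (B.indicator fun s => (u s)⁻¹) := hu.inv.indicator hB
  calc ∫⁻ t in P ∩ ψ ⁻¹' B, v t / u (ψ t) ∂μ
      = ∫⁻ t in P, v t * B.indicator (fun s => (u s)⁻¹) (ψ t) ∂μ := by
        rw [inter_comm, ← Measure.restrict_restrict (hψ hB), ← lintegral_indicator (hψ hB)]
        refine lintegral_congr fun t => ?_
        by_cases ht : ψ t ∈ B
        · simp [indicator, ht, div_eq_mul_inv]
        · simp [indicator, ht]
    _ = ∫⁻ t, B.indicator (fun s => (u s)⁻¹) (ψ t) ∂((μ.withDensity v).restrict P) := by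
        rw [restrict_withDensity hP]
        exact (lintegral_withDensity_eq_lintegral_mul _ hv (hg.comp hψ)).symm
    _ = ∫⁻ s, B.indicator (fun s => (u s)⁻¹) s ∂((μ.withDensity v).restrict P).map ψ :=
        (lintegral_map hg hψ).symm
    _ ≤ ∫⁻ s, B.indicator (fun s => (u s)⁻¹) s ∂(c • μ.withDensity u) :=
        lintegral_mono' h le_rfl
    _ = c * ∫⁻ s, u s * B.indicator (fun s => (u s)⁻¹) s ∂μ := by
        rw [lintegral_smul_measure, lintegral_withDensity_eq_lintegral_mul _ hu hg]
        rfl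
    _ ≤ c * ∫⁻ s, B.indicator 1 s ∂μ := by
        gcongr with s
        by_cases hs : s ∈ B
        · simp [hs, ENNReal.mul_inv_le_one]
        · simp [hs]
    _ = c * μ B := by rw [lintegral_indicator_one hB]

/-! ### Transport maps between decreasing densities -/

instance nullSingletonClass_halfLine_withDensity (v : ℝ → ℝ≥0∞) : NullSingletonClass (halfLine.withDensity v) :=
  ⟨fun x => withDensity_absolutelyContinuous _ _ (by
    rw [halfLine]; exact measure_singleton x)⟩

theorem halfLine_withDensity_Ioc (v : ℝ → ℝ≥0∞) {a b : ℝ} (ha : 0 ≤ a) :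
    halfLine.withDensity v (Ioc a b) = ∫⁻ x in Ioc a b, v x := by
  rw [withDensity_apply _ measurableSet_Ioc, halfLine, Measure.restrict_restrict measurableSet_Ioc,
    inter_eq_left.2 (show Ioc a b ⊆ Ioi 0 from fun x hx => ha.trans_lt hx.1)]

theorem mul_le_setLIntegral_Ioc {u : ℝ → ℝ≥0∞} (hu : Antitone u) (a b : ℝ) :
    ENNReal.ofReal (b - a) * u b ≤ ∫⁻ x in Ioc a b, u x := by
  calc ENNReal.ofReal (b - a) * u b = ∫⁻ _ in Ioc a b, u b := by simp [mul_comm]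
    _ ≤ ∫⁻ x in Ioc a b, u x := setLIntegral_mono' measurableSet_Ioc fun x hx => hu hx.2

theorem setLIntegral_Ioc_le_mul {u : ℝ → ℝ≥0∞} (hu : Antitone u) (a b : ℝ) :
    ∫⁻ x in Ioc a b, u x ≤ ENNReal.ofReal (b - a) * u a := by
  calc ∫⁻ x in Ioc a b, u x ≤ ∫⁻ _ in Ioc a b, u a :=
        setLIntegral_mono' measurableSet_Ioc fun x hx => hu hx.1.le
    _ = ENNReal.ofReal (b - a) * u a := by simp [mul_comm]

theorem setLIntegral_Ioc_add (u : ℝ → ℝ≥0∞) {a b c : ℝ} (hab : a ≤ b) (hbc : b ≤ c) :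
    (∫⁻ x in Ioc a b, u x) + ∫⁻ x in Ioc b c, u x = ∫⁻ x in Ioc a c, u x := by
  rw [← Ioc_union_Ioc_eq_Ioc hab hbc, lintegral_union measurableSet_Ioc]
  exact Set.disjoint_left.2 fun x hx hx' => hx.2.not_gt hx'.1

theorem setLIntegral_Ioc_add_Ioi (u : ℝ → ℝ≥0∞) {a b : ℝ} (hab : a ≤ b) :
    (∫⁻ x in Ioc a b, u x) + ∫⁻ x in Ioi b, u x = ∫⁻ x in Ioi a, u x := by
  rw [← Ioc_union_Ioi_eq_Ioi hab, lintegral_union measurableSet_Ioi]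
  exact Set.disjoint_left.2 fun x hx hx' => hx.2.not_gt hx'

/-- The factor 2 in `2 * U (φ t) = V t` leaves room for the pointwise bound: transporting with `U (φ
t) = V t` could force `φ t = t` and would leave no mass of `u` between `φ t` and `t` to compare
with. -/
theorem exists_head_transport {u v : ℝ → ℝ≥0∞} (hu : Antitone u) (hv : Antitone v)
    (hfin : ∀ t, 0 < t → ∫⁻ s in Ioc 0 t, u s ≠ ∞)
    (hle : ∀ t, 0 < t → ∫⁻ s in Ioc 0 t, v s ≤ ∫⁻ s in Ioc 0 t, u s) :
    ∃ ψ : ℝ → ℝ, Measurable ψ ∧ (∀ t, 0 < t → 0 < ψ t) ∧ (∀ t, 0 < t → v t ≤ 2 * u (ψ t)) ∧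
      ∀ B, MeasurableSet B → ∫⁻ t in ψ ⁻¹' B, v t / u (ψ t) ∂halfLine ≤ 2 * halfLine B := by
  classical
  set U : ℝ → ℝ≥0∞ := fun t => ∫⁻ s in Ioc 0 t, u s with hU
  set V : ℝ → ℝ≥0∞ := fun t => ∫⁻ s in Ioc 0 t, v s with hV
  set P : Set ℝ := {t | 0 < t ∧ V t ≠ 0} with hPdef
  have hVfin : ∀ t, 0 < t → V t ≠ ∞ := fun t ht => ne_top_of_le_ne_top (hfin t ht) (hle t ht)
  have hVmono : Monotone V := fun s t hst => lintegral_mono_set (Ioc_subset_Ioc_right hst)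
  have hP : P.OrdConnected := ⟨fun x hx y _ z hz => ⟨hx.1.trans_le hz.1, fun h0 =>
    hx.2 (le_antisymm ((hVmono hz.1).trans h0.le) zero_le)⟩⟩
  have hex : ∀ t ∈ P, ∃ s, 0 < s ∧ s ≤ t ∧ 2 * U s = V t := by
    intro t ht
    have hhalf : V t / 2 ≤ U t := ENNReal.half_le_self.trans (hle t ht.1)
    obtain ⟨s, hs, hsc⟩ := exists_setLIntegral_Ioc_eq hu.measurable ht.1.le (hfin t ht.1) hhalf
    have h2 : 2 * U s = V t := by
      change 2 * (∫⁻ x in Ioc 0 s, u x) = V t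
      rw [hsc, ENNReal.mul_div_cancel two_ne_zero ENNReal.ofNat_ne_top]
    refine ⟨s, lt_of_le_of_ne hs.1 ?_, hs.2, h2⟩
    rintro rfl
    exact ht.2 (by rw [← h2]; simp [hU])
  choose! φ hφ0 hφt hφ using hex
  have hUadd : ∀ s t, 0 ≤ s → s ≤ t → U s + ∫⁻ x in Ioc s t, u x = U t :=
    fun s t hs hst => setLIntegral_Ioc_add u hs hst
  -- At most half of the mass of `u` on `(0, t]` sits before `φ t`, because `2 * U (φ t) = V t ≤ U
  -- t`.
  have hbound : ∀ t ∈ P, U (φ t) ≤ ∫⁻ x in Ioc (φ t) t, u x := by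
    intro t ht
    have h1 := hUadd _ _ (hφ0 t ht).le (hφt t ht)
    have h2 : U (φ t) + U (φ t) ≤ U (φ t) + ∫⁻ x in Ioc (φ t) t, u x := by
      rw [h1, ← two_mul, hφ t ht]; exact hle t ht.1
    exact (ENNReal.add_le_add_iff_left (hfin _ (hφ0 t ht))).1 h2
  have hune : ∀ t ∈ P, u (φ t) ≠ 0 := by
    intro t ht h0
    have h1 := (hbound t ht).trans (setLIntegral_Ioc_le_mul hu _ _)
    rw [h0, mul_zero, nonpos_iff_eq_zero] at h1
    exact ht.2 (by rw [← hφ t ht, h1, mul_zero])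
  have hmono : MonotoneOn φ P := by
    intro s hs t ht hst
    by_contra! hlt
    have h1 := hUadd _ _ (hφ0 t ht).le hlt.le
    have h2 : U (φ t) + ∫⁻ x in Ioc (φ t) (φ s), u x ≤ U (φ t) + 0 := by
      rw [h1, add_zero, ← ENNReal.mul_le_mul_iff_right two_ne_zero ENNReal.ofNat_ne_top, hφ t ht,
        hφ s hs]
      exact hVmono hst
    have h3 := (ENNReal.add_le_add_iff_left (hfin _ (hφ0 t ht))).1 h2
    have h4 := (mul_le_setLIntegral_Ioc hu (φ t) (φ s)).trans h3
    rw [nonpos_iff_eq_zero, mul_eq_zero, ENNReal.ofReal_eq_zero] at h4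
    rcases h4 with h4 | h4
    · linarith
    · exact hune s hs h4
  have hv0 : ∀ t, 0 < t → ENNReal.ofReal t * v t ≤ V t := fun t _ => by
    simpa using mul_le_setLIntegral_Ioc hv 0 t
  have hvP : ∀ t, 0 < t → t ∉ P → v t = 0 := by
    intro t ht htP
    have : V t = 0 := by
      by_contra h
      exact htP ⟨ht, h⟩
    have h1 := hv0 t ht
    rw [this, nonpos_iff_eq_zero, mul_eq_zero, ENNReal.ofReal_eq_zero] at h1
    exact h1.resolve_left (not_le.2 ht)
  -- Outside `P` the density `v` vanishes on the half-line, so the value there is immaterial; the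
  -- identity keeps `ψ` positive and measurable.
  set ψ : ℝ → ℝ := P.piecewise φ id with hψdef
  have hψP : ∀ t ∈ P, ψ t = φ t := fun t ht => piecewise_eq_of_mem _ _ _ ht
  have hψ : Measurable ψ := measurable_piecewise_of_monotoneOn hP hmono
  have hmap : ((halfLine.withDensity v).restrict P).map ψ ≤ (2 : ℝ≥0∞) • halfLine.withDensity u := by
    refine map_restrict_le_of_Ioc_le hψ hP.measurableSet (fun t ht => ht.1)
      (fun t ht => by rw [hψP t ht]; exact hφ0 t ht) (fun a b ha => ?_) (fun a b ha => ?_)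
      fun s hs t ht hst => ?_
    · rw [halfLine_withDensity_Ioc _ ha.le]
      rcases le_or_gt b a with hba | hab
      · simp [Ioc_eq_empty (not_lt.2 hba)]
      · exact ne_top_of_le_ne_top (hVfin b (ha.trans hab))
          (lintegral_mono_set (Ioc_subset_Ioc_left ha.le))
    · rw [Measure.smul_apply, smul_eq_mul, halfLine_withDensity_Ioc _ ha.le]
      refine ENNReal.mul_ne_top ENNReal.ofNat_ne_top ?_
      rcases le_or_gt b a with hba | hab
      · simp [Ioc_eq_empty (not_lt.2 hba)]
      · exact ne_top_of_le_ne_top (hfin b (ha.trans hab))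
          (lintegral_mono_set (Ioc_subset_Ioc_left ha.le))
    · rw [hψP s hs, hψP t ht, Measure.smul_apply, smul_eq_mul,
        halfLine_withDensity_Ioc _ hs.1.le, halfLine_withDensity_Ioc _ (hφ0 s hs).le]
      have h1 : V s + ∫⁻ x in Ioc s t, v x = V t := setLIntegral_Ioc_add v hs.1.le hst
      have h2 := hUadd _ _ (hφ0 s hs).le (hmono hs ht hst)
      refine (ENNReal.add_le_add_iff_left (hVfin s hs.1)).1 (le_of_eq ?_)
      rw [h1, ← hφ s hs, ← mul_add, h2, hφ t ht]
  refine ⟨ψ, hψ, fun t ht => ?_, fun t ht => ?_, fun B hB => ?_⟩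
  · by_cases htP : t ∈ P
    · rw [hψP t htP]
      exact hφ0 t htP
    · rwa [hψdef, piecewise_eq_of_notMem _ _ _ htP]
  · by_cases htP : t ∈ P
    · rw [hψP t htP]
      -- Monotonicity used at both ends: `t v(t) ≤ V(t) = 2 U(φ t) ≤ 2 ∫_{φ t}^t u ≤ 2 t u(φ t)`.
      have h1 : ENNReal.ofReal t * v t ≤ ENNReal.ofReal t * (2 * u (φ t)) := by
        calc ENNReal.ofReal t * v t ≤ V t := hv0 t ht
          _ = 2 * U (φ t) := (hφ t htP).symm
          _ ≤ 2 * (ENNReal.ofReal t * u (φ t)) := by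
              gcongr
              refine ((hbound t htP).trans (setLIntegral_Ioc_le_mul hu _ _)).trans ?_
              gcongr
              linarith [hφ0 t htP]
          _ = ENNReal.ofReal t * (2 * u (φ t)) := by ring
      exact (ENNReal.mul_le_mul_iff_right (by simpa using ht) ENNReal.ofReal_ne_top).1 h1
    · rw [hvP t ht htP]; exact zero_le
  · refine le_trans ?_ (setLIntegral_div_comp_le hu.measurable hv.measurable hψ hP.measurableSet
      hmap hB)
    rw [← Measure.restrict_restrict hP.measurableSet, ← lintegral_indicator hP.measurableSet]
    refine lintegral_mono_ae (ae_restrict_of_ae ?_)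
    filter_upwards [ae_restrict_mem measurableSet_Ioi] with t ht
    by_cases htP : t ∈ P
    · simp [htP]
    · simp [hvP t ht htP]

/-- Transport alone preserves mass but may spread it over a large set with small weights, which
would ruin the support bound. Replacing it by the identity wherever the weight is below 1 repairs
this at the price of a factor 2. -/
theorem exists_tail_transport {u v : ℝ → ℝ≥0∞} (hu : Antitone u) (hv : Antitone v)
    (hutop : ∀ t, 0 < t → u t ≠ ∞) (hfin : ∀ t, 0 < t → ∫⁻ s in Ioi t, u s ≠ ∞)
    (hle : ∀ t, 0 < t → ∫⁻ s in Ioi t, v s ≤ ∫⁻ s in Ioi t, u s) :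
    ∃ ψ : ℝ → ℝ, Measurable ψ ∧ (∀ t, 0 < t → 0 < ψ t) ∧
      (∀ᵐ t ∂halfLine, v t ≠ 0 → u (ψ t) ≠ 0) ∧
      (∀ B, MeasurableSet B → ∫⁻ t in ψ ⁻¹' B, v t / u (ψ t) ∂halfLine ≤ 2 * halfLine B) ∧
      ∀ B, MeasurableSet B → halfLine ({t | v t ≠ 0} ∩ ψ ⁻¹' B) ≤ 2 * halfLine B := by
  classical
  set U : ℝ → ℝ≥0∞ := fun t => ∫⁻ s in Ioi t, u s with hU
  set V : ℝ → ℝ≥0∞ := fun t => ∫⁻ s in Ioi t, v s with hV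
  set P : Set ℝ := {t | 0 < t ∧ V t ≠ 0} with hPdef
  have hVfin : ∀ t, 0 < t → V t ≠ ∞ := fun t ht => ne_top_of_le_ne_top (hfin t ht) (hle t ht)
  have hVanti : Antitone V := fun s t hst => lintegral_mono_set (Ioi_subset_Ioi hst)
  have hP : P.OrdConnected := ⟨fun x hx y hy z hz => ⟨hx.1.trans_le hz.1, fun h0 =>
    hy.2 (le_antisymm ((hVanti hz.2).trans h0.le) zero_le)⟩⟩
  have hUadd : ∀ s t, s ≤ t → (∫⁻ x in Ioc s t, u x) + U t = U s :=
    fun s t hst => setLIntegral_Ioc_add_Ioi u hst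
  have hIoc : ∀ a b, 0 < a → ∫⁻ x in Ioc a b, u x ≠ ∞ := fun a b ha =>
    ne_top_of_le_ne_top (hfin a ha) (lintegral_mono_set Ioc_subset_Ioi_self)
  have hex : ∀ t ∈ P, ∃ s, t ≤ s ∧ U s = V t := by
    intro t ht
    have hUt0 : U t ≠ 0 := fun h0 => ht.2 (le_antisymm ((hle t ht.1).trans h0.le) zero_le)
    -- The point `s` must leave the mass `U t - V t` of `u` on `(t, s]`. Strict inequality, from `V
    -- t ≠ 0`, ensures that a bounded interval already carries that much, so the intermediate value
    -- argument applies.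
    have hc : U t - V t < U t := ENNReal.sub_lt_self (hfin t ht.1) hUt0 ht.2
    obtain ⟨b, hab, hb⟩ : ∃ b, t ≤ b ∧ U t - V t ≤ ∫⁻ x in Ioc t b, u x := by
      have hUn : ⋃ n : ℕ, Ioc t (t + n) = Ioi t := by
        refine subset_antisymm (iUnion_subset fun n => Ioc_subset_Ioi_self) fun x hx => ?_
        obtain ⟨n, hn⟩ := exists_nat_ge (x - t)
        exact mem_iUnion.2 ⟨n, hx, by linarith⟩
      have hsup : U t = ⨆ n : ℕ, ∫⁻ x in Ioc t (t + n), u x := by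
        rw [← setLIntegral_iUnion_of_directed, hUn]
        refine Monotone.directed_le fun m n hmn => Ioc_subset_Ioc_right ?_
        have : (m : ℝ) ≤ n := by exact_mod_cast hmn
        linarith
      rw [hsup] at hc
      obtain ⟨n, hn⟩ := lt_iSup_iff.1 hc
      rw [← hsup] at hn
      exact ⟨t + n, by simp, hn.le⟩
    obtain ⟨s, hs, hsc⟩ := exists_setLIntegral_Ioc_eq hu.measurable hab (hIoc t b ht.1) hb
    refine ⟨s, hs.1, ?_⟩
    have h1 := hUadd t s hs.1
    rw [hsc] at h1
    have h2 : U t - V t + V t = U t := tsub_add_cancel_of_le (hle t ht.1)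
    exact (ENNReal.add_right_inj (ne_top_of_le_ne_top (hfin t ht.1) tsub_le_self)).1
      (h1.trans h2.symm)
  choose! φ hφt hφ using hex
  have hφ0 : ∀ t ∈ P, 0 < φ t := fun t ht => ht.1.trans_le (hφt t ht)
  have hune : ∀ t ∈ P, u (φ t) ≠ 0 := by
    intro t ht h0
    refine ht.2 ?_
    rw [← hφ t ht, ← nonpos_iff_eq_zero]
    calc U (φ t) ≤ ∫⁻ _ in Ioi (φ t), 0 :=
          setLIntegral_mono' measurableSet_Ioi fun x hx => (hu (le_of_lt hx)).trans h0.le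
      _ = 0 := by simp
  have hmono : MonotoneOn φ P := by
    intro s hs t ht hst
    by_contra! hlt
    have h1 := hUadd _ _ hlt.le
    have h2 : (∫⁻ x in Ioc (φ t) (φ s), u x) + U (φ s) ≤ 0 + U (φ s) := by
      rw [h1, zero_add, hφ t ht, hφ s hs]
      exact hVanti hst
    have h3 := (ENNReal.add_le_add_iff_right (hfin _ (hφ0 s hs))).1 h2
    have h4 := (mul_le_setLIntegral_Ioc hu (φ t) (φ s)).trans h3
    rw [nonpos_iff_eq_zero, mul_eq_zero, ENNReal.ofReal_eq_zero] at h4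
    rcases h4 with h4 | h4
    · linarith
    · exact hune s hs h4
  -- Only almost everywhere: `v` may be nonzero at the left endpoint of `{V = 0}`, but at no other
  -- point of that set.
  have hvP : ∀ᵐ t ∂halfLine, t ∉ P → v t = 0 := by
    have hsub : {t | 0 < t ∧ V t = 0 ∧ v t ≠ 0}.Subsingleton := by
      intro s hs t ht
      have key : ∀ s t, s < t → V s = 0 → v t = 0 := by
        intro s t hst h0
        have h1 : ENNReal.ofReal (t - s) * v t ≤ V s :=
          (mul_le_setLIntegral_Ioc hv s t).trans (lintegral_mono_set Ioc_subset_Ioi_self)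
        rw [h0, nonpos_iff_eq_zero, mul_eq_zero, ENNReal.ofReal_eq_zero] at h1
        exact h1.resolve_left (by linarith)
      rcases lt_trichotomy s t with h | h | h
      · exact absurd (key s t h hs.2.1) ht.2.2
      · exact h
      · exact absurd (key t s h ht.2.1) hs.2.2
    have hnull : ∀ᵐ t ∂halfLine, t ∉ {t | 0 < t ∧ V t = 0 ∧ v t ≠ 0} :=
      ae_restrict_of_ae (measure_eq_zero_iff_ae_notMem.1 (hsub.measure_zero volume))
    filter_upwards [hnull, ae_restrict_mem measurableSet_Ioi] with t ht ht0 htP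
    by_contra hvt
    refine ht ⟨ht0, ?_, hvt⟩
    by_contra h
    exact htP ⟨ht0, h⟩
  set ψ₀ : ℝ → ℝ := P.piecewise φ id
  have hψ₀P : ∀ t ∈ P, ψ₀ t = φ t := fun t ht => piecewise_eq_of_mem _ _ _ ht
  have hψ₀ : Measurable ψ₀ := measurable_piecewise_of_monotoneOn hP hmono
  have hmap : ((halfLine.withDensity v).restrict P).map ψ₀ ≤
      (1 : ℝ≥0∞) • halfLine.withDensity u := by
    refine map_restrict_le_of_Ioc_le hψ₀ hP.measurableSet (fun t ht => ht.1)
      (fun t ht => by rw [hψ₀P t ht]; exact hφ0 t ht) (fun a b ha => ?_) (fun a b ha => ?_)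
      fun s hs t ht hst => ?_
    · rw [halfLine_withDensity_Ioc _ ha.le]
      exact ne_top_of_le_ne_top (hVfin a ha) (lintegral_mono_set Ioc_subset_Ioi_self)
    · rw [one_smul, halfLine_withDensity_Ioc _ ha.le]
      exact hIoc a b ha
    · rw [hψ₀P s hs, hψ₀P t ht, one_smul,
        halfLine_withDensity_Ioc _ hs.1.le, halfLine_withDensity_Ioc _ (hφ0 s hs).le]
      have h1 : (∫⁻ x in Ioc s t, v x) + V t = V s := setLIntegral_Ioc_add_Ioi v hst
      have h2 := hUadd _ _ (hmono hs ht hst)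
      refine (ENNReal.add_le_add_iff_right (hVfin t ht.1)).1 (le_of_eq ?_)
      rw [h1, ← hφ t ht, h2, hφ s hs]
  have hpush : ∀ B, MeasurableSet B →
      ∫⁻ t in P ∩ ψ₀ ⁻¹' B, v t / u (ψ₀ t) ∂halfLine ≤ halfLine B := fun B hB => by
    simpa using setLIntegral_div_comp_le hu.measurable hv.measurable hψ₀ hP.measurableSet hmap hB
  -- The part of `P` on which the transport weight `v / (u ∘ ψ₀)` is at least 1.
  set A : Set ℝ := P ∩ {t | u (ψ₀ t) ≤ v t}
  have hA : MeasurableSet A :=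
    hP.measurableSet.inter (measurableSet_le (hu.measurable.comp hψ₀) hv.measurable)
  set ψ : ℝ → ℝ := A.piecewise ψ₀ id with hψdef
  have hψA : ∀ t ∈ A, ψ t = ψ₀ t := fun t ht => piecewise_eq_of_mem _ _ _ ht
  have hψA' : ∀ t ∉ A, ψ t = t := fun t ht => piecewise_eq_of_notMem _ _ _ ht
  have hψ : Measurable ψ := hψ₀.piecewise hA measurable_id
  have hlt : ∀ t ∈ P, t ∉ A → v t ≤ u t := fun t ht htA => by
    have h1 : v t < u (ψ₀ t) := by
      by_contra! h
      exact htA ⟨ht, h⟩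
    rw [hψ₀P t ht] at h1
    exact h1.le.trans (hu (hφt t ht))
  refine ⟨ψ, hψ, fun t ht => ?_, ?_, fun B hB => ?_, fun B hB => ?_⟩
  · by_cases htA : t ∈ A
    · rw [hψA t htA, hψ₀P t htA.1]
      exact hφ0 t htA.1
    · rwa [hψA' t htA]
  · filter_upwards [hvP] with t ht hvt
    have htP : t ∈ P := by
      by_contra h
      exact hvt (ht h)
    by_cases htA : t ∈ A
    · rw [hψA t htA, hψ₀P t htP]
      exact hune t htP
    · rw [hψA' t htA]
      exact fun h0 => hune t htP (le_antisymm ((hu (hφt t htP)).trans h0.le) zero_le)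
  · have h1 : ∫⁻ t in ψ ⁻¹' B ∩ A, v t / u (ψ t) ∂halfLine ≤ halfLine B := by
      refine le_trans ?_ (hpush B hB)
      calc ∫⁻ t in ψ ⁻¹' B ∩ A, v t / u (ψ t) ∂halfLine
          = ∫⁻ t in ψ ⁻¹' B ∩ A, v t / u (ψ₀ t) ∂halfLine :=
            setLIntegral_congr_fun ((hψ hB).inter hA) fun t ht => by simp only [hψA t ht.2]
        _ ≤ ∫⁻ t in P ∩ ψ₀ ⁻¹' B, v t / u (ψ₀ t) ∂halfLine := by
            refine lintegral_mono_set fun t ht => ⟨ht.2.1, ?_⟩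
            have := ht.1
            rwa [mem_preimage, hψA t ht.2] at this
    have h2 : ∫⁻ t in ψ ⁻¹' B \ A, v t / u (ψ t) ∂halfLine ≤ halfLine B := by
      calc ∫⁻ t in ψ ⁻¹' B \ A, v t / u (ψ t) ∂halfLine
          ≤ ∫⁻ t in ψ ⁻¹' B \ A, 1 ∂halfLine := by
            refine setLIntegral_mono_ae' ((hψ hB).diff hA) ?_
            filter_upwards [hvP] with t ht htA
            rw [hψA' t htA.2]
            by_cases htP : t ∈ P
            · exact ENNReal.div_le_of_le_mul (by rw [one_mul]; exact hlt t htP htA.2)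
            · simp [ht htP]
        _ = halfLine (ψ ⁻¹' B \ A) := setLIntegral_one _
        _ ≤ halfLine B := measure_mono fun t ht => by
            have := ht.1
            rwa [mem_preimage, hψA' t ht.2] at this
    rw [← lintegral_inter_add_sdiff _ _ hA, two_mul]
    exact add_le_add h1 h2
  -- On `A` the constant 1 is dominated by the weight, so the mass estimate becomes a measure
  -- estimate.
  · have h1 : halfLine (A ∩ ψ₀ ⁻¹' B) ≤ halfLine B := by
      refine le_trans ?_ (hpush B hB)
      rw [← setLIntegral_one]
      calc ∫⁻ _ in A ∩ ψ₀ ⁻¹' B, 1 ∂halfLine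
          ≤ ∫⁻ t in A ∩ ψ₀ ⁻¹' B, v t / u (ψ₀ t) ∂halfLine := by
            refine setLIntegral_mono' (hA.inter (hψ₀ hB)) fun t ht => ?_
            have htP : t ∈ P := ht.1.1
            have hle : u (ψ₀ t) ≤ v t := ht.1.2
            have hne : u (ψ₀ t) ≠ 0 := by rw [hψ₀P t htP]; exact hune t htP
            have hnt : u (ψ₀ t) ≠ ∞ := by rw [hψ₀P t htP]; exact hutop _ (hφ0 t htP)
            rw [ENNReal.le_div_iff_mul_le (Or.inl hne) (Or.inl hnt), one_mul]
            exact hle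
        _ ≤ ∫⁻ t in P ∩ ψ₀ ⁻¹' B, v t / u (ψ₀ t) ∂halfLine :=
            lintegral_mono_set (inter_subset_inter_left _ inter_subset_left)
    calc halfLine ({t | v t ≠ 0} ∩ ψ ⁻¹' B) ≤ halfLine ((A ∩ ψ₀ ⁻¹' B) ∪ B) := by
          refine measure_mono fun t ht => ?_
          have hB' : ψ t ∈ B := ht.2
          by_cases htA : t ∈ A
          · rw [hψA t htA] at hB'
            exact Or.inl ⟨htA, hB'⟩
          · rw [hψA' t htA] at hB'
            exact Or.inr hB'
      _ ≤ halfLine (A ∩ ψ₀ ⁻¹' B) + halfLine B := measure_union_le _ _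
      _ ≤ 2 * halfLine B := by rw [two_mul]; gcongr

/-! ### Weighted composition operators and their norms -/

variable {𝕜 : Type*} [RCLike 𝕜]

theorem enorm_rclike_ofReal (x : ℝ) : ‖(x : 𝕜)‖ₑ = ‖x‖ₑ := by
  rw [← ofReal_norm, ← ofReal_norm, RCLike.norm_ofReal, Real.norm_eq_abs]

/-- This makes composition with `ψ` compatible with classes modulo null sets: a null set may have a
preimage of positive measure, but then only where the weight vanishes. -/
theorem ae_comp_of_ae {w ψ : ℝ → ℝ}
    (hac : ∀ B, MeasurableSet B → halfLine B = 0 → halfLine ({t | w t ≠ 0} ∩ ψ ⁻¹' B) = 0)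
    {p : ℝ → Prop} (hp : ∀ᵐ t ∂halfLine, p t) : ∀ᵐ t ∂halfLine, w t ≠ 0 → p (ψ t) := by
  obtain ⟨s, hs, hsm, hs0⟩ := exists_measurable_superset_of_null (ae_iff.1 hp)
  filter_upwards [measure_eq_zero_iff_ae_notMem.1 (hac s hsm hs0)] with t ht hwt
  by_contra h
  exact ht ⟨hwt, hs h⟩

/-- The operator `x ↦ w · (x ∘ ψ)` on measurable functions modulo equality almost everywhere. -/
noncomputable def weightedComp (w : ℝ → ℝ) (ψ : ℝ → ℝ) (hw : Measurable w) (hψ : Measurable ψ)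
    (hac : ∀ B, MeasurableSet B → halfLine B = 0 → halfLine ({t | w t ≠ 0} ∩ ψ ⁻¹' B) = 0) :
    X 𝕜 →ₗ[𝕜] X 𝕜 :=
  have hsm : ∀ x : X 𝕜, AEStronglyMeasurable (fun t => ((w t : ℝ) : 𝕜) * x (ψ t)) halfLine :=
    fun x => ((RCLike.continuous_ofReal.comp_stronglyMeasurable hw.stronglyMeasurable).mul
      (x.stronglyMeasurable.comp_measurable hψ)).aestronglyMeasurable
  { toFun x := AEEqFun.mk _ (hsm x)
    map_add' x y := by
      refine AEEqFun.ext ?_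
      filter_upwards [AEEqFun.coeFn_mk _ (hsm (x + y)), AEEqFun.coeFn_mk _ (hsm x),
        AEEqFun.coeFn_mk _ (hsm y), AEEqFun.coeFn_add (AEEqFun.mk _ (hsm x)) (AEEqFun.mk _ (hsm y)),
        ae_comp_of_ae hac (AEEqFun.coeFn_add x y)] with t h1 h2 h3 h4 h5
      rw [h4, h1, Pi.add_apply, h2, h3]
      by_cases hwt : w t = 0
      · simp [hwt]
      · rw [h5 hwt, Pi.add_apply, mul_add]
    map_smul' c x := by
      refine AEEqFun.ext ?_
      filter_upwards [AEEqFun.coeFn_mk _ (hsm (c • x)), AEEqFun.coeFn_mk _ (hsm x),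
        AEEqFun.coeFn_smul c (AEEqFun.mk _ (hsm x)), ae_comp_of_ae hac (AEEqFun.coeFn_smul c x)]
        with t h1 h2 h3 h4
      rw [RingHom.id_apply, h3, h1, Pi.smul_apply, h2]
      by_cases hwt : w t = 0
      · simp [hwt]
      · rw [h4 hwt, Pi.smul_apply, smul_eq_mul, smul_eq_mul]
        ring }

section WeightedComp

variable {w ψ : ℝ → ℝ} {hw : Measurable w} {hψ : Measurable ψ}
  {hac : ∀ B, MeasurableSet B → halfLine B = 0 → halfLine ({t | w t ≠ 0} ∩ ψ ⁻¹' B) = 0}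

theorem weightedComp_coeFn (x : X 𝕜) :
    ∀ᵐ t ∂halfLine, weightedComp w ψ hw hψ hac x t = ((w t : ℝ) : 𝕜) * x (ψ t) :=
  AEEqFun.coeFn_mk _ _

theorem opNormLZero_weightedComp_le {C : ℝ≥0∞}
    (h : ∀ B, MeasurableSet B → halfLine ({t | w t ≠ 0} ∩ ψ ⁻¹' B) ≤ C * halfLine B) :
    opNormLZero (weightedComp w ψ hw hψ hac : X 𝕜 →ₗ[𝕜] X 𝕜) ≤ C := by
  refine iSup_le fun x => ENNReal.div_le_of_le_mul ?_
  have hB : MeasurableSet {t | (x : X 𝕜) t ≠ 0} :=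
    (x : X 𝕜).stronglyMeasurable.measurableSet_support
  refine le_trans (measure_mono_ae ?_) (h _ hB)
  filter_upwards [weightedComp_coeFn (hw := hw) (hψ := hψ) (hac := hac) (x : X 𝕜)] with t ht hne
  have hne' : weightedComp w ψ hw hψ hac (x : X 𝕜) t ≠ 0 := hne
  rw [ht] at hne'
  exact ⟨fun h0 => hne' (by simp [h0]), fun h0 => hne' (by rw [h0, mul_zero])⟩

/-- Change of variables: `∫ |w|^r |x ∘ ψ|^r` is the integral of `|x|^r` against the image under `ψ`
of `|w|^r dt`, which the hypothesis bounds by `C dt`. -/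
theorem opNormL_weightedComp_le {r : ℝ} (hr : 0 < r) {C : ℝ≥0∞}
    (h : ∀ B, MeasurableSet B → ∫⁻ t in ψ ⁻¹' B, ‖w t‖ₑ ^ r ∂halfLine ≤ C * halfLine B) :
    opNormL (ENNReal.ofReal r) (weightedComp w ψ hw hψ hac : X 𝕜 →ₗ[𝕜] X 𝕜) ≤ C ^ (1 / r) := by
  refine iSup_le fun x => ENNReal.div_le_of_le_mul ?_
  have hr0 : ENNReal.ofReal r ≠ 0 := by simpa using hr
  rw [eLpNorm_eq_lintegral_rpow_enorm_toReal hr0 ENNReal.ofReal_ne_top,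
    eLpNorm_eq_lintegral_rpow_enorm_toReal hr0 ENNReal.ofReal_ne_top, ENNReal.toReal_ofReal hr.le,
    ← ENNReal.mul_rpow_of_nonneg _ _ (by positivity)]
  refine ENNReal.rpow_le_rpow ?_ (by positivity)
  have hwm : Measurable fun t => ‖w t‖ₑ ^ r := hw.enorm.pow_const r
  have hxm : Measurable fun t => ‖(x : X 𝕜) t‖ₑ ^ r :=
    (x : X 𝕜).stronglyMeasurable.enorm.pow_const r
  have hmap : (halfLine.withDensity fun t => ‖w t‖ₑ ^ r).map ψ ≤ C • halfLine := by
    refine Measure.le_iff.2 fun B hB => ?_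
    rw [Measure.map_apply hψ hB, withDensity_apply _ (hψ hB)]
    exact h B hB
  calc ∫⁻ t, ‖weightedComp w ψ hw hψ hac (x : X 𝕜) t‖ₑ ^ r ∂halfLine
      = ∫⁻ t, ‖w t‖ₑ ^ r * ‖(x : X 𝕜) (ψ t)‖ₑ ^ r ∂halfLine := by
        refine lintegral_congr_ae ?_
        filter_upwards [weightedComp_coeFn (hw := hw) (hψ := hψ) (hac := hac) (x : X 𝕜)] with t ht
        rw [ht, enorm_mul, ENNReal.mul_rpow_of_nonneg _ _ hr.le, enorm_rclike_ofReal]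
    _ = ∫⁻ t, ‖(x : X 𝕜) (ψ t)‖ₑ ^ r ∂(halfLine.withDensity fun t => ‖w t‖ₑ ^ r) :=
        (lintegral_withDensity_eq_lintegral_mul _ hwm (hxm.comp hψ)).symm
    _ = ∫⁻ t, ‖(x : X 𝕜) t‖ₑ ^ r ∂(halfLine.withDensity fun t => ‖w t‖ₑ ^ r).map ψ :=
        (lintegral_map hxm hψ).symm
    _ ≤ ∫⁻ t, ‖(x : X 𝕜) t‖ₑ ^ r ∂(C • halfLine) := lintegral_mono' hmap le_rfl
    _ = C * ∫⁻ t, ‖(x : X 𝕜) t‖ₑ ^ r ∂halfLine := lintegral_smul_measure _ _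

theorem opNormL_top_weightedComp_le {C : ℝ≥0∞} (h : ∀ᵐ t ∂halfLine, ‖w t‖ₑ ≤ C) :
    opNormL ∞ (weightedComp w ψ hw hψ hac : X 𝕜 →ₗ[𝕜] X 𝕜) ≤ C := by
  refine iSup_le fun x => ENNReal.div_le_of_le_mul ?_
  rw [eLpNorm_exponent_top, eLpNorm_exponent_top]
  refine essSup_le_of_ae_le _ ?_
  filter_upwards [weightedComp_coeFn (hw := hw) (hψ := hψ) (hac := hac) (x : X 𝕜), h,
    ae_comp_of_ae hac (ae_le_eLpNormEssSup (f := (x : X 𝕜)) (μ := halfLine))] with t ht hC hx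
  rw [ht, enorm_mul, enorm_rclike_ofReal]
  by_cases hwt : w t = 0
  · simp [hwt]
  · exact mul_le_mul' hC (hx hwt)

end WeightedComp

/-! ### Rearrangements: powers and finiteness -/

section Rearr

variable {E : Type*} [NormedAddCommGroup E]

theorem rearr_antitone (u : ℝ → E) : Antitone (rearr u) := fun _ _ hst =>
  sInf_le_sInf fun _ hx => le_trans (α := ℝ≥0∞) hx (ENNReal.ofReal_le_ofReal hst)

/-- The map `s ↦ s ^ r` is an order automorphism of `[0, ∞]`, hence commutes with the infimum
defining the rearrangement. -/
theorem rearr_norm_rpow (u : ℝ → E) {r : ℝ} (hr : 0 < r) (t : ℝ) :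
    rearr (fun x => ‖u x‖ ^ r) t = rearr u t ^ r := by
  have he : ∀ x, ‖‖u x‖ ^ r‖ₑ = ‖u x‖ₑ ^ r := fun x => by
    rw [Real.enorm_rpow_of_nonneg (norm_nonneg _) hr.le, enorm_norm]
  have h := (ENNReal.orderIsoRpow r hr).map_sInf
    {s : ℝ≥0∞ | halfLine {x | s < ‖u x‖ₑ} ≤ ENNReal.ofReal t}
  rw [← sInf_image] at h
  refine Eq.trans ?_ h.symm
  unfold rearr
  congr 1
  ext s
  simp only [he, mem_ofPred_eq, mem_image, ENNReal.orderIsoRpow_apply]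
  constructor
  · intro hs
    refine ⟨s ^ r⁻¹, ?_, ENNReal.rpow_inv_rpow hr.ne' s⟩
    have : {x | s ^ r⁻¹ < ‖u x‖ₑ} = {x | s < ‖u x‖ₑ ^ r} := by
      ext x
      exact ENNReal.rpow_inv_lt_iff hr
    rwa [this]
  · rintro ⟨s', hs', rfl⟩
    have : {x | s' ^ r < ‖u x‖ₑ ^ r} = {x | s' < ‖u x‖ₑ} := by
      ext x
      exact ENNReal.rpow_lt_rpow_iff hr
    rwa [this]

/-- The superlevel sets at heights `s₀ + n` decrease to the empty set; since the first has finite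
measure, their measures tend to 0 and eventually fall below `t`. -/
theorem rearr_ne_top {u : ℝ → 𝕜} (hu : StronglyMeasurable u) {s₀ : NNReal}
    (h : halfLine {x | s₀ < ‖u x‖ₑ} ≠ ∞) {t : ℝ} (ht : 0 < t) : rearr u t ≠ ∞ := by
  have hm : ∀ s : ℝ≥0∞, MeasurableSet {x | s < ‖u x‖ₑ} := fun s =>
    measurableSet_lt measurable_const hu.enorm
  have hI : ⋂ n : ℕ, {x | ((s₀ + n : NNReal) : ℝ≥0∞) < ‖u x‖ₑ} = ∅ := by
    refine eq_empty_of_forall_notMem fun x hx => ?_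
    obtain ⟨n, hn⟩ := exists_nat_ge ‖u x‖₊
    have h1 := mem_iInter.1 hx n
    have h2 : s₀ + n < ‖u x‖₊ := by
      have : ((s₀ + n : NNReal) : ℝ≥0∞) < ‖u x‖ₑ := h1
      rwa [enorm_eq_nnnorm, ENNReal.coe_lt_coe] at this
    exact absurd (hn.trans (le_add_of_nonneg_left zero_le)) h2.not_ge
  have htend := tendsto_measure_iInter_atTop (μ := halfLine)
    (s := fun n : ℕ => {x | ((s₀ + n : NNReal) : ℝ≥0∞) < ‖u x‖ₑ})
    (fun n => (hm _).nullMeasurableSet) (fun m n hmn x hx => lt_of_le_of_lt (b := ((s₀ + n : NNReal) : ℝ≥0∞))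
      (ENNReal.coe_le_coe.2 (by gcongr)) hx) ⟨0, by simpa using h⟩
  rw [hI, measure_empty] at htend
  obtain ⟨n, hn⟩ := (htend.eventually_lt_const (ENNReal.ofReal_pos.2 ht)).exists
  exact ne_top_of_le_ne_top ENNReal.coe_ne_top (sInf_le hn.le)

end Rearr

section Levels

theorem level_of_mem_LZero {f : X 𝕜} (hf : f ∈ LZero 𝕜) :
    ∃ s : NNReal, halfLine {x | (s : ℝ≥0∞) < ‖f x‖ₑ} ≠ ∞ := by
  refine ⟨0, ne_top_of_le_ne_top (ne_of_lt (show suppMeasure f < ∞ from hf))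
    (measure_mono fun x hx h0 => ?_)⟩
  have hx' : ((0 : NNReal) : ℝ≥0∞) < ‖f x‖ₑ := hx
  simp [h0] at hx'

theorem level_of_mem_LSpace {f : X 𝕜} {r : ℝ} (hr : 0 < r)
    (hf : f ∈ LSpace 𝕜 (ENNReal.ofReal r)) :
    ∃ s : NNReal, halfLine {x | (s : ℝ≥0∞) < ‖f x‖ₑ} ≠ ∞ := by
  have h := MemLp.meas_ge_lt_top (Lp.mem_Lp_iff_memLp.1 hf) (by simpa using hr)
    ENNReal.ofReal_ne_top (one_ne_zero (α := NNReal))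
  refine ⟨1, ne_top_of_le_ne_top h.ne (measure_mono fun x hx => ?_)⟩
  have hx' : ((1 : NNReal) : ℝ≥0∞) < ‖f x‖ₑ := hx
  exact ENNReal.coe_le_coe.1 hx'.le

theorem level_of_mem_LSpace_top {f : X 𝕜} (hf : f ∈ LSpace 𝕜 ∞) :
    ∃ s : NNReal, halfLine {x | (s : ℝ≥0∞) < ‖f x‖ₑ} ≠ ∞ := by
  have hfin : eLpNormEssSup f halfLine ≠ ∞ := by
    have := (Lp.mem_Lp_iff_memLp.1 hf).eLpNorm_ne_top
    rwa [eLpNorm_exponent_top] at this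
  refine ⟨(eLpNormEssSup f halfLine).toNNReal, ?_⟩
  rw [ENNReal.coe_toNNReal hfin, meas_eLpNormEssSup_lt]
  exact ENNReal.zero_ne_top

theorem level_add {f g : X 𝕜} (hf : ∃ s : NNReal, halfLine {x | (s : ℝ≥0∞) < ‖f x‖ₑ} ≠ ∞)
    (hg : ∃ s : NNReal, halfLine {x | (s : ℝ≥0∞) < ‖g x‖ₑ} ≠ ∞) :
    ∃ s : NNReal, halfLine {x | (s : ℝ≥0∞) < ‖(f + g) x‖ₑ} ≠ ∞ := by
  obtain ⟨s, hs⟩ := hf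
  obtain ⟨t, ht⟩ := hg
  refine ⟨s + t, ne_top_of_le_ne_top (ENNReal.add_ne_top.2 ⟨hs, ht⟩)
    ((measure_mono_ae ?_).trans (measure_union_le _ _))⟩
  filter_upwards [AEEqFun.coeFn_add f g] with x hx hlt
  have hlt' : ((s + t : NNReal) : ℝ≥0∞) < ‖(f + g) x‖ₑ := hlt
  by_contra! h
  have h1 : ¬ ((s : ℝ≥0∞) < ‖f x‖ₑ ∨ (t : ℝ≥0∞) < ‖g x‖ₑ) := h
  rw [not_or, not_lt, not_lt] at h1
  refine hlt'.not_ge ?_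
  rw [hx, Pi.add_apply, ENNReal.coe_add]
  exact (enorm_add_le _ _).trans (add_le_add h1.1 h1.2)

end Levels

theorem enorm_eq_rearr {f : X 𝕜} (hf : IsOwnRearr f) (hfin : ∀ t, 0 < t → rearr f t ≠ ∞) :
    ∀ᵐ t ∂halfLine, ‖f t‖ₑ = rearr f t := by
  filter_upwards [hf, ae_restrict_mem measurableSet_Ioi] with t ht ht0
  rw [ht, enorm_rclike_ofReal, Real.enorm_eq_ofReal ENNReal.toReal_nonneg,
    ENNReal.ofReal_toReal (hfin t ht0)]

/-- Split `f = a + b`. Where `a` vanishes, `μ(f) = |b|` almost everywhere, which is `q`-integrable;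
where it does not, a set of finite measure, `μ(f)` beyond `t` is at most its value at `t`. -/
theorem setLIntegral_Ioi_rearr_ne_top {f : X 𝕜} {q : ℝ} (hq : 0 < q)
    (hf : f ∈ LZero 𝕜 ⊔ LSpace 𝕜 (ENNReal.ofReal q)) (hown : IsOwnRearr f)
    (hfin : ∀ t, 0 < t → rearr f t ≠ ∞) {t : ℝ} (ht : 0 < t) :
    ∫⁻ s in Ioi t, rearr f s ^ q ≠ ∞ := by
  obtain ⟨a, ha, b, hb, rfl⟩ := AddSubgroup.mem_sup.1 hf
  have hS : MeasurableSet {x | a x ≠ 0} := a.stronglyMeasurable.measurableSet_support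
  have hq0 : ENNReal.ofReal q ≠ 0 := by simpa using hq
  have hbint : ∫⁻ s, ‖b s‖ₑ ^ q ∂halfLine < ∞ := by
    have := lintegral_rpow_enorm_lt_top_of_eLpNorm_lt_top hq0 ENNReal.ofReal_ne_top
      (Lp.mem_Lp_iff_memLp.1 hb).2
    rwa [ENNReal.toReal_ofReal hq.le] at this
  have hle : ∀ᵐ s ∂halfLine, s ∈ Ioi t → rearr (a + b : X 𝕜) s ^ q ≤
      {x | a x ≠ 0}.indicator (fun _ => rearr (a + b : X 𝕜) t ^ q) s + ‖b s‖ₑ ^ q := by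
    filter_upwards [enorm_eq_rearr hown hfin, AEEqFun.coeFn_add a b] with s hs hab hst
    by_cases has : a s = 0
    · rw [← hs, hab, Pi.add_apply, has, zero_add]
      exact le_add_self
    · rw [indicator_of_mem (show s ∈ {x | a x ≠ 0} from has)]
      exact le_add_right (ENNReal.rpow_le_rpow (rearr_antitone _ (le_of_lt hst)) hq.le)
  have hrestr : volume.restrict (Ioi t) = halfLine.restrict (Ioi t) := by
    rw [halfLine, Measure.restrict_restrict measurableSet_Ioi,
      inter_eq_left.2 (Ioi_subset_Ioi ht.le)]
  rw [hrestr]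
  refine ne_top_of_le_ne_top ?_ ((setLIntegral_mono_ae' measurableSet_Ioi hle).trans
    (setLIntegral_le_lintegral _ _))
  rw [lintegral_add_left (measurable_const.indicator hS), lintegral_indicator_const hS]
  refine ENNReal.add_ne_top.2 ⟨ENNReal.mul_ne_top ?_ ?_, hbint.ne⟩
  · exact ENNReal.rpow_ne_top_of_nonneg hq.le (hfin t ht)
  · exact ne_of_lt (show suppMeasure a < ∞ from ha)

/-- On a bounded interval `L_∞` embeds into `L_p`, so both summands are `p`-integrable there. -/
theorem setLIntegral_Ioc_rearr_ne_top {f : X 𝕜} {p : ℝ} (hp : 0 < p)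
    (hf : f ∈ LSpace 𝕜 (ENNReal.ofReal p) ⊔ LSpace 𝕜 ∞) (hown : IsOwnRearr f)
    (hfin : ∀ t, 0 < t → rearr f t ≠ ∞) (t : ℝ) :
    ∫⁻ s in Ioc 0 t, rearr f s ^ p ≠ ∞ := by
  obtain ⟨a, ha, b, hb, rfl⟩ := AddSubgroup.mem_sup.1 hf
  have hrestr : volume.restrict (Ioc 0 t) = halfLine.restrict (Ioc 0 t) := by
    rw [halfLine, Measure.restrict_restrict measurableSet_Ioc,
      inter_eq_left.2 Ioc_subset_Ioi_self]
  have hfm : IsFiniteMeasure (halfLine.restrict (Ioc 0 t)) := by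
    rw [← hrestr]; infer_instance
  have hp0 : ENNReal.ofReal p ≠ 0 := by simpa using hp
  have ha' := (Lp.mem_Lp_iff_memLp.1 ha).restrict (Ioc 0 t)
  have hb' := ((Lp.mem_Lp_iff_memLp.1 hb).restrict (Ioc 0 t)).mono_exponent
    (le_top (a := ENNReal.ofReal p))
  have hab := lintegral_rpow_enorm_lt_top_of_eLpNorm_lt_top hp0 ENNReal.ofReal_ne_top
    (ha'.add hb').2
  rw [ENNReal.toReal_ofReal hp.le] at hab
  rw [hrestr]
  refine ne_of_lt (lt_of_le_of_lt (lintegral_mono_ae (ae_restrict_of_ae ?_)) hab)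
  filter_upwards [enorm_eq_rearr hown hfin, AEEqFun.coeFn_add a b] with s hs h
  rw [← hs, h]

/-! ### The operators sending `f` to `g` -/

/-- The weight by which `rearr f ∘ ψ` is multiplied to give `rearr g`. -/
noncomputable def ratioWeight (f g : ℝ → 𝕜) (ψ : ℝ → ℝ) (t : ℝ) : ℝ :=
  (rearr g t / rearr f (ψ t)).toReal

theorem measurable_ratioWeight (f g : ℝ → 𝕜) {ψ : ℝ → ℝ} (hψ : Measurable ψ) :
    Measurable (ratioWeight f g ψ) :=
  ((rearr_antitone g).measurable.div ((rearr_antitone f).measurable.comp hψ)).ennreal_toReal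

theorem enorm_ratioWeight_le (f g : ℝ → 𝕜) (ψ : ℝ → ℝ) (t : ℝ) :
    ‖ratioWeight f g ψ t‖ₑ ≤ rearr g t / rearr f (ψ t) := by
  rw [ratioWeight, Real.enorm_eq_ofReal ENNReal.toReal_nonneg]
  exact ENNReal.ofReal_toReal_le

theorem enorm_ratioWeight_rpow_le (f g : ℝ → 𝕜) (ψ : ℝ → ℝ) {r : ℝ} (hr : 0 < r) (t : ℝ) :
    ‖ratioWeight f g ψ t‖ₑ ^ r ≤ rearr g t ^ r / rearr f (ψ t) ^ r := by
  rw [← ENNReal.div_rpow_of_nonneg _ _ hr.le]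
  exact ENNReal.rpow_le_rpow (enorm_ratioWeight_le f g ψ t) hr.le

/-- The integral bound over `ψ⁻¹(B)` is zero when `B` is null, and a nonnegative function with zero
integral vanishes almost everywhere. -/
theorem null_preimage_of_setLIntegral_le {w ψ : ℝ → ℝ} (hw : Measurable w) (hψ : Measurable ψ)
    {r : ℝ} (hr : 0 < r) {C : ℝ≥0∞}
    (h : ∀ B, MeasurableSet B → ∫⁻ t in ψ ⁻¹' B, ‖w t‖ₑ ^ r ∂halfLine ≤ C * halfLine B) :
    ∀ B, MeasurableSet B → halfLine B = 0 → halfLine ({t | w t ≠ 0} ∩ ψ ⁻¹' B) = 0 := by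
  intro B hB hB0
  have h0 := h B hB
  rw [hB0, mul_zero, nonpos_iff_eq_zero, lintegral_eq_zero_iff (hw.enorm.pow_const r)] at h0
  rw [measure_eq_zero_iff_ae_notMem]
  filter_upwards [(ae_restrict_iff' (hψ hB)).1 h0] with t ht hmem
  have := ht hmem.2
  simp only [Pi.zero_apply, ENNReal.rpow_eq_zero_iff, hr, enorm_eq_zero, and_true] at this
  rcases this with h | h
  · exact hmem.1 h
  · linarith [h.2]

theorem weightedComp_ratioWeight_eq {f g : X 𝕜} {ψ : ℝ → ℝ} (hψ : Measurable ψ)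
    (hac : ∀ B, MeasurableSet B → halfLine B = 0 →
      halfLine ({t | ratioWeight f g ψ t ≠ 0} ∩ ψ ⁻¹' B) = 0)
    (hf : IsOwnRearr f) (hg : IsOwnRearr g)
    (hffin : ∀ t, 0 < t → rearr f t ≠ ∞) (hgfin : ∀ t, 0 < t → rearr g t ≠ ∞)
    (hpos : ∀ t, 0 < t → 0 < ψ t)
    (hne : ∀ᵐ t ∂halfLine, rearr g t ≠ 0 → rearr f (ψ t) ≠ 0) :
    weightedComp (ratioWeight f g ψ) ψ (measurable_ratioWeight f g hψ) hψ hac f = g := by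
  refine AEEqFun.ext ?_
  filter_upwards [weightedComp_coeFn (hw := measurable_ratioWeight f g hψ) (hψ := hψ)
    (hac := hac) f, ae_comp_of_ae hac hf, hg, hne, ae_restrict_mem measurableSet_Ioi]
    with t h1 h2 h3 h4 ht
  rw [h1, h3]
  by_cases hg0 : rearr g t = 0
  · simp [ratioWeight, hg0]
  have hf0 := h4 hg0
  have hftop := hffin _ (hpos t ht)
  have hprod : ratioWeight f g ψ t * (rearr f (ψ t)).toReal = (rearr g t).toReal := by
    rw [ratioWeight, ← ENNReal.toReal_mul, ENNReal.div_mul_cancel hf0 hftop]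
  have hw : ratioWeight f g ψ t ≠ 0 := by
    rw [ratioWeight, ENNReal.toReal_ne_zero]
    exact ⟨ENNReal.div_ne_zero.2 ⟨hg0, hftop⟩, ENNReal.div_ne_top (hgfin t ht) hf0⟩
  rw [h2 hw, ← hprod, RCLike.ofReal_mul]

theorem exists_operator_of_tailMajorized {q : ℝ} (hq : 0 < q) {f g : X 𝕜}
    (hf : f ∈ LZero 𝕜 ⊔ LSpace 𝕜 (ENNReal.ofReal q))
    (hg : g ∈ LZero 𝕜 ⊔ LSpace 𝕜 (ENNReal.ofReal q))
    (hfo : IsOwnRearr f) (hgo : IsOwnRearr g)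
    (hmaj : TailMajorized (fun t => ‖g t‖ ^ q) (fun t => ‖f t‖ ^ q)) :
    ∃ T : X 𝕜 →ₗ[𝕜] X 𝕜, T f = g ∧ opNormLZero T ≤ 2 ∧
      opNormL (ENNReal.ofReal q) T ≤ (2 : ℝ≥0∞) ^ (1 / q) := by
  have hfinite : ∀ {h : X 𝕜}, h ∈ LZero 𝕜 ⊔ LSpace 𝕜 (ENNReal.ofReal q) →
      ∀ t, 0 < t → rearr h t ≠ ∞ := by
    intro h hh t ht
    obtain ⟨a, ha, b, hb, rfl⟩ := AddSubgroup.mem_sup.1 hh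
    obtain ⟨s, hs⟩ := level_add (level_of_mem_LZero ha) (level_of_mem_LSpace hq hb)
    exact rearr_ne_top (a + b).stronglyMeasurable hs ht
  have hanti : ∀ h : X 𝕜, Antitone fun t => rearr h t ^ q := fun h s t hst =>
    ENNReal.rpow_le_rpow (rearr_antitone h hst) hq.le
  obtain ⟨ψ, hψ, hpos, hne, hint, hsupp⟩ := exists_tail_transport (hanti f) (hanti g)
    (fun t ht => ENNReal.rpow_ne_top_of_nonneg hq.le (hfinite hf t ht))
    (fun t ht => setLIntegral_Ioi_rearr_ne_top hq hf hfo (hfinite hf) ht)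
    (fun t ht => by simpa only [rearr_norm_rpow _ hq] using hmaj t ht)
  have hw : ∀ B, MeasurableSet B →
      ∫⁻ t in ψ ⁻¹' B, ‖ratioWeight f g ψ t‖ₑ ^ q ∂halfLine ≤ 2 * halfLine B := fun B hB =>
    (lintegral_mono fun t => enorm_ratioWeight_rpow_le f g ψ hq t).trans (hint B hB)
  refine ⟨weightedComp (ratioWeight f g ψ) ψ (measurable_ratioWeight f g hψ) hψ
    (null_preimage_of_setLIntegral_le (measurable_ratioWeight f g hψ) hψ hq hw),
    weightedComp_ratioWeight_eq hψ _ hfo hgo (hfinite hf) (hfinite hg) hpos ?_,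
    opNormLZero_weightedComp_le fun B hB => le_trans (measure_mono ?_) (hsupp B hB),
    opNormL_weightedComp_le hq hw⟩
  · filter_upwards [hne] with t ht hgt hft
    refine ht ?_ ?_
    · simp [ENNReal.rpow_eq_zero_iff, hgt, hq.not_gt]
    · simp [hft, hq]
  · refine inter_subset_inter_left _ fun t ht hgt => ht ?_
    have : rearr g t = 0 := (ENNReal.rpow_eq_zero_iff_of_pos hq).1 hgt
    simp [ratioWeight, this]

theorem exists_operator_of_headMajorized {p : ℝ} (hp : 0 < p) {f g : X 𝕜}
    (hf : f ∈ LSpace 𝕜 (ENNReal.ofReal p) ⊔ LSpace 𝕜 ∞)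
    (hg : g ∈ LSpace 𝕜 (ENNReal.ofReal p) ⊔ LSpace 𝕜 ∞)
    (hfo : IsOwnRearr f) (hgo : IsOwnRearr g)
    (hmaj : HeadMajorized (fun t => ‖g t‖ ^ p) (fun t => ‖f t‖ ^ p)) :
    ∃ T : X 𝕜 →ₗ[𝕜] X 𝕜, T f = g ∧ opNormL (ENNReal.ofReal p) T ≤ (2 : ℝ≥0∞) ^ (1 / p) ∧
      opNormL ∞ T ≤ (2 : ℝ≥0∞) ^ (1 / p) := by
  have hfinite : ∀ {h : X 𝕜}, h ∈ LSpace 𝕜 (ENNReal.ofReal p) ⊔ LSpace 𝕜 ∞ →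
      ∀ t, 0 < t → rearr h t ≠ ∞ := by
    intro h hh t ht
    obtain ⟨a, ha, b, hb, rfl⟩ := AddSubgroup.mem_sup.1 hh
    obtain ⟨s, hs⟩ := level_add (level_of_mem_LSpace hp ha) (level_of_mem_LSpace_top hb)
    exact rearr_ne_top (a + b).stronglyMeasurable hs ht
  have hanti : ∀ h : X 𝕜, Antitone fun t => rearr h t ^ p := fun h s t hst =>
    ENNReal.rpow_le_rpow (rearr_antitone h hst) hp.le
  obtain ⟨ψ, hψ, hpos, hle, hint⟩ := exists_head_transport (hanti f) (hanti g)
    (fun t _ => setLIntegral_Ioc_rearr_ne_top hp hf hfo (hfinite hf) t)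
    (fun t ht => by simpa only [rearr_norm_rpow _ hp] using hmaj t ht)
  have hw : ∀ B, MeasurableSet B →
      ∫⁻ t in ψ ⁻¹' B, ‖ratioWeight f g ψ t‖ₑ ^ p ∂halfLine ≤ 2 * halfLine B := fun B hB =>
    (lintegral_mono fun t => enorm_ratioWeight_rpow_le f g ψ hp t).trans (hint B hB)
  -- The pointwise bound `v ≤ 2 (u ∘ ψ)` after taking `p`-th roots; it yields the `L_∞` norm and
  -- also the nonvanishing of `μ(f) ∘ ψ` where `μ(g) ≠ 0`.
  have hle' : ∀ t, 0 < t → rearr g t ≤ (2 : ℝ≥0∞) ^ (1 / p) * rearr f (ψ t) := fun t ht => by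
    rw [← ENNReal.rpow_le_rpow_iff hp, ENNReal.mul_rpow_of_nonneg _ _ hp.le, ← ENNReal.rpow_mul,
      one_div_mul_cancel hp.ne', ENNReal.rpow_one]
    exact hle t ht
  refine ⟨weightedComp (ratioWeight f g ψ) ψ (measurable_ratioWeight f g hψ) hψ
    (null_preimage_of_setLIntegral_le (measurable_ratioWeight f g hψ) hψ hp hw),
    weightedComp_ratioWeight_eq hψ _ hfo hgo (hfinite hf) (hfinite hg) hpos ?_,
    opNormL_weightedComp_le hp hw, opNormL_top_weightedComp_le ?_⟩
  · filter_upwards [ae_restrict_mem measurableSet_Ioi] with t ht hgt hft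
    have := hle' t ht
    rw [hft, mul_zero, nonpos_iff_eq_zero] at this
    exact hgt this
  · filter_upwards [ae_restrict_mem measurableSet_Ioi] with t ht
    exact (enorm_ratioWeight_le f g ψ t).trans (ENNReal.div_le_of_le_mul (hle' t ht))

end HeadTail

theorem mainTheorem9 {𝕜 : Type*} [RCLike 𝕜] :
    (∀ q : ℝ, 0 < q → ∀ f g : HeadTail.X 𝕜,
      f ∈ HeadTail.LZero 𝕜 ⊔ HeadTail.LSpace 𝕜 (ENNReal.ofReal q) →
      g ∈ HeadTail.LZero 𝕜 ⊔ HeadTail.LSpace 𝕜 (ENNReal.ofReal q) →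
      HeadTail.IsOwnRearr f → HeadTail.IsOwnRearr g →
      HeadTail.TailMajorized (fun t => ‖g t‖ ^ q) (fun t => ‖f t‖ ^ q) →
      ∃ T : HeadTail.X 𝕜 →ₗ[𝕜] HeadTail.X 𝕜, T f = g ∧
        HeadTail.opNormLZero T ≤ 4 ∧
        HeadTail.opNormL (ENNReal.ofReal q) T ≤ 2 * (3 : ℝ≥0∞) ^ (1 / q)) ∧
    (∀ p : ℝ, 0 < p → ∀ f g : HeadTail.X 𝕜,
      f ∈ HeadTail.LSpace 𝕜 (ENNReal.ofReal p) ⊔ HeadTail.LSpace 𝕜 ∞ →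
      g ∈ HeadTail.LSpace 𝕜 (ENNReal.ofReal p) ⊔ HeadTail.LSpace 𝕜 ∞ →
      HeadTail.IsOwnRearr f → HeadTail.IsOwnRearr g →
      HeadTail.HeadMajorized (fun t => ‖g t‖ ^ p) (fun t => ‖f t‖ ^ p) →
      ∃ T : HeadTail.X 𝕜 →ₗ[𝕜] HeadTail.X 𝕜, T f = g ∧
        HeadTail.opNormL (ENNReal.ofReal p) T ≤ 2 * (3 : ℝ≥0∞) ^ (1 / p) ∧
        HeadTail.opNormL ∞ T ≤ 2 * (2 : ℝ≥0∞) ^ (1 / p)) := by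
  -- The construction gives the smaller constants `2` and `2 ^ (1 / r)`; only a comparison of
  -- constants remains.
  have hle : ∀ {c : ℝ≥0∞} {r : ℝ}, 0 < r → 2 ≤ c → (2 : ℝ≥0∞) ^ (1 / r) ≤ 2 * c ^ (1 / r) :=
    fun hr hc => (ENNReal.rpow_le_rpow hc (by positivity)).trans
      (le_mul_of_one_le_left zero_le one_le_two)
  refine ⟨fun q hq f g hf hg hfo hgo hmaj => ?_, fun p hp f g hf hg hfo hgo hmaj => ?_⟩
  · obtain ⟨T, hT, h0, hr⟩ := HeadTail.exists_operator_of_tailMajorized hq hf hg hfo hgo hmaj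
    exact ⟨T, hT, h0.trans (by norm_num), hr.trans (hle hq (by norm_num))⟩
  · obtain ⟨T, hT, hr, hi⟩ := HeadTail.exists_operator_of_headMajorized hp hf hg hfo hgo hmaj
    exact ⟨T, hT, hr.trans (hle hp (by norm_num)), hi.trans (hle hp le_rfl)⟩
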